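/- Let $k>1$ be an integer, let $A=B=\mathbb{Z}/(k)$, and let $I$ be a finite set with $|I|>1$ and $\gcd(|I|-1,k)=1$. Let $\varphi_2\colon B\to A$ be a surjective group homomorphism, and let $\varphi_1\colon A\to B$ be the map with $\varphi_1(0)=0$ and $\varphi_1(x)=1$ for all $x\neq 0$ (so $\varphi_1(-x)=\varphi_1(x)$ for all $x$). On $X=A\times B\times I$ define, for $(a,b,i)\in X$, the permutation $$\sigma_{(a,b,i)}(c,d,j)=\begin{cases}(c,\,d+\varphi_1(a-c),\,j)&\text{if } i=j,\\ (c+\varphi_2(b),\,d,\,j)&\text{if } i\neq j,\end{cases}$$ and let $r\colon X\times X\to X\times X$, $r(x,y)=\bigl(\sigma_x(y),\,\sigma_{\sigma_x(y)}^{-1}(x)\bigr)$, be the corresponding non-degenerate involutive set-theoretic solution of the Yang-Baxter equation. Let $\mathcal{G}(X,r)$ be its permutation group, i.e. the subgroup of $\mathrm{Sym}(X)$ generated by $\{\sigma_x\mid x\in X\}$. For the abelian group $A$ let $A\wr A$ be the wreath product, i.e. the semidirect product $W\rtimes A$, where $W$ is the group of all functions $f\colon A\to A$ under pointwise addition and $A$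 acts on $W$ by $(hf)(x)=f(x-h)$. Then: 1. $\mathcal{G}(X,r)$ is isomorphic to $(A\wr A)^{|I|}$, the direct product of $|I|$ copies of $A\wr A$. 2. The derived length of $\mathcal{G}(X,r)$ is $2$. 3. $\mathcal{G}(X,r)$ is nilpotent if and only if $k=p^{\alpha}$ for some prime $p$ and some integer $\alpha\geq 1$; in this case, its nilpotency class equals $(\alpha(p-1)+1)\,p^{\alpha-1}$. 4. In particular, if $k=p$ is prime, then the nilpotency class of $\mathcal{G}(X,r)$ is $p$. -/

import Mathlib

/-- A non-degenerate involutive set-theoretic solution `(X, r)` of the Yang-Baxter equation on a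
non-empty set `X`, where `r (x, y) = (σ_x y, γ_y x)`. -/
structure YBESolution (X : Type*) where
  nonempty : Nonempty X
  r : X × X → X × X
  involutive : ∀ p, r (r p) = p
  sigma_bijective : ∀ x, Function.Bijective (fun y => (r (x, y)).1)
  gamma_bijective : ∀ y, Function.Bijective (fun x => (r (x, y)).2)
  /-- `r₁₂ r₂₃ r₁₂ = r₂₃ r₁₂ r₂₃` on `X × X × X`. -/
  braid :
    let r₁₂ : X × X × X → X × X × X := fun t =>
      ((r (t.1, t.2.1)).1, (r (t.1, t.2.1)).2, t.2.2)
    let r₂₃ : X × X × X → X × X × X := fun t => (t.1, r t.2)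
    r₁₂ ∘ r₂₃ ∘ r₁₂ = r₂₃ ∘ r₁₂ ∘ r₂₃

namespace YBESolution

/-- The permutation `σ_x` of `X`, where `r (x, y) = (σ_x y, γ_y x)`. -/
noncomputable def sigma {X : Type*} (S : YBESolution X) (x : X) : Equiv.Perm X :=
  Equiv.ofBijective (fun y => (S.r (x, y)).1) (S.sigma_bijective x)

/-- The permutation group `𝒢(X, r)`: the subgroup of `Sym(X)` generated by all `σ_x`. -/
noncomputable def permutationGroup {X : Type*} (S : YBESolution X) :
    Subgroup (Equiv.Perm X) :=
  Subgroup.closure (Set.range S.sigma)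

end YBESolution

section Construction

variable {A B I : Type*} [AddCommGroup A] [AddCommGroup B]

open Classical in
/-- The permutation `σ_{(a,b,i)}` of `A × B × I`: it maps `(c, d, j)` to `(c, d + φ₁(a - c), j)`
if `i = j`, and to `(c + φ₂(b), d, j)` if `i ≠ j`. -/
noncomputable def twistPerm (φ₁ : A → B) (φ₂ : B →+ A) (x : A × B × I) :
    Equiv.Perm (A × B × I) where
  toFun y :=
    if x.2.2 = y.2.2 then (y.1, y.2.1 + φ₁ (x.1 - y.1), y.2.2)
    else (y.1 + φ₂ x.2.1, y.2.1, y.2.2)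
  invFun y :=
    if x.2.2 = y.2.2 then (y.1, y.2.1 - φ₁ (x.1 - y.1), y.2.2)
    else (y.1 - φ₂ x.2.1, y.2.1, y.2.2)
  left_inv y := by by_cases h : x.2.2 = y.2.2 <;> simp [h]
  right_inv y := by by_cases h : x.2.2 = y.2.2 <;> simp [h]

/-- The map `r(x, y) = (σ_x(y), σ_{σ_x(y)}⁻¹(x))` on pairs of elements of `A × B × I`. -/
noncomputable def twistMap (φ₁ : A → B) (φ₂ : B →+ A)
    (p : (A × B × I) × (A × B × I)) : (A × B × I) × (A × B × I) :=
  (twistPerm φ₁ φ₂ p.1 p.2, (twistPerm φ₁ φ₂ (twistPerm φ₁ φ₂ p.1 p.2)).symm p.1)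


theorem twistPerm_twistPerm_symm (φ₁ : A → B) (φ₂ : B →+ A)
    (x y : A × B × I) :
    (twistPerm φ₁ φ₂ (twistPerm φ₁ φ₂ x y)).symm x = (twistPerm φ₁ φ₂ y).symm x := by
  obtain ⟨a, b, i⟩ := x
  obtain ⟨c, d, j⟩ := y
  by_cases h : i = j
  · simp [twistPerm, h]
  · simp [twistPerm, h, Ne.symm h]

theorem twistMap_eq (φ₁ : A → B) (φ₂ : B →+ A)
    (x y : A × B × I) :
    twistMap φ₁ φ₂ (x, y) = (twistPerm φ₁ φ₂ x y, (twistPerm φ₁ φ₂ y).symm x) := by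
  simp only [twistMap, twistPerm_twistPerm_symm]

/-- The solution `(X(A, B, I), r)` of the Yang-Baxter equation on `X(A, B, I) = A × B × I`. -/
noncomputable def twistSolution [Nonempty I] (φ₁ : A → B) (hφ₁ : ∀ a, φ₁ (-a) = φ₁ a)
    (φ₂ : B →+ A) : YBESolution (A × B × I) where
  nonempty := inferInstance
  r := twistMap φ₁ φ₂
  involutive := by
    rintro ⟨x, y⟩
    simp [twistMap]
  sigma_bijective x := (twistPerm φ₁ φ₂ x).bijective
  gamma_bijective y := by
    simp only [twistMap_eq]
    exact (twistPerm φ₁ φ₂ y).symm.bijective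
  braid := by
    have hsub : ∀ u v : A, φ₁ (u - v) = φ₁ (v - u) := fun u v => by rw [← hφ₁, neg_sub]
    intro r₁₂ r₂₃
    funext ⟨⟨a, b, i⟩, ⟨c, d, j⟩, ⟨e, f, k⟩⟩
    simp only [r₁₂, r₂₃, Function.comp, twistMap_eq]
    by_cases hij : i = j
    · subst hij
      by_cases hik : i = k
      · subst hik
        simp [twistPerm, hsub, add_right_comm]
        constructor <;> abel
      · simp [twistPerm, hik, Ne.symm hik]
        rw [hsub c a]
        abel
    · by_cases hik : i = k
      · subst hik
        simp [twistPerm, hij, Ne.symm hij]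
        rw [hsub e (a - φ₂ d), hsub (e + φ₂ d) a, sub_sub, add_comm (φ₂ d) e]
        exact ⟨rfl, by abel, rfl⟩
      · by_cases hjk : j = k
        · subst hjk
          simp [twistPerm, hij, Ne.symm hij]
          rw [hsub c e]
          abel
        · simp [twistPerm, hij, hik, hjk, Ne.symm hij, Ne.symm hik, Ne.symm hjk]
          exact ⟨by abel, by abel, by abel⟩

end Construction

/-! Each layer `A × B × {j}` is preserved by every `σ_x`, which acts on layer `i` by a base element
of the wreath product and on every other layer by a translation. So the permutation group embeds in
the `I`-th power of the wreath product, and it remains to see that the generators give everything.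
The complemented delta functions `φ₁ (a - ·)` span the base over `ZMod k`. Once the base parts are
removed, the translations `c (1 - e_l)` remain; their sum over `l` is `(|I| - 1) c`, and `|I| - 1`
is a unit mod `k`.

In one wreath product a commutator of a base element `f` with an element over `h` is `f - shift ^ h
f`. Hence the `n`-th lower central term vanishes iff `(shift - 1) ^ n = 0`, that is, iff `X ^ k - 1`
divides `(X - 1) ^ n` over `ZMod k`. Reduction modulo a prime divisor of `k` forces `k` to be a
prime power.

For `k = p ^ (m + 1)` let `Φ` be the cyclotomic polynomial of index `k` and `T = X ^ k - 1`. Then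
`(X - 1) ^ (p ^ (m + 1) - p ^ m) = Φ + p g` with `g(1) = -1`, and `Φ² ≡ p Φ` mod `T`, so its `(m +
1)`-st power is `p ^ m Φ u` modulo `T` and `p ^ (m + 1)`, with `u(1) = ±1`. A further factor `(X -
1) ^ p ^ m` kills this, and one factor fewer does not. -/

open Polynomial
open scoped commutatorElement

/-! ### Divisibility of powers of `X - 1` by `X ^ k - 1` over `ZMod k`. -/

namespace Polynomial

/-- Expansion of `(Φ + p g) ^ (a + 1)` modulo `T` when `Φ² ≡ p Φ` modulo `T`. -/
theorem exists_expansion_add_mul_pow {R K : Type*} [CommRing R] [CommRing K] (ε : R →+* K)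
    {p Φ g T s₀ : R} (hΦ : Φ * Φ = p * Φ + T * s₀) (hg : ε g = -1) (a : ℕ) :
    ∃ u s : R, (Φ + p * g) ^ (a + 1) = p ^ a * (Φ * u + p * g ^ (a + 1)) + T * s ∧
      ε u = (-1) ^ a := by
  induction a with
  | zero => exact ⟨1, 0, by ring, by simp⟩
  | succ a ih =>
    obtain ⟨u, s, h, hu⟩ := ih
    -- With `ε g = -1` the last two terms map to `(-1) ^ (a + 1)` each, so `ε` of the new `u` is
    -- `(-1) ^ (a + 1)`.
    refine ⟨u + g ^ (a + 1) + g * u, p ^ a * s₀ * u + (Φ + p * g) * s, ?_, ?_⟩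
    · rw [pow_succ' _ (a + 1), h]
      linear_combination (p ^ a * u) * hΦ
    · simp only [map_add, map_mul, map_pow, hg, hu]
      ring

section PrimePower

variable (p m : ℕ) [hp : Fact p.Prime]

theorem exists_eq_add_natCast_mul_of_map_eq {P Q : ℤ[X]}
    (h : P.map (Int.castRingHom (ZMod p)) = Q.map (Int.castRingHom (ZMod p))) :
    ∃ g : ℤ[X], P = Q + (p : ℤ[X]) * g := by
  have h0 : (C (p : ℤ)) ∣ P - Q := by
    rw [C_dvd_iff_dvd_coeff]
    intro i
    rw [← ZMod.intCast_zmod_eq_zero_iff_dvd]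
    have := congrArg (fun f => coeff f i) h
    simp only [coeff_map, eq_intCast] at this
    simp [this]
  obtain ⟨g, hg⟩ := h0
  refine ⟨g, ?_⟩
  have : (C (p : ℤ)) = (p : ℤ[X]) := by simp
  rw [← this, ← hg]
  ring

theorem map_sub_one_pow_totient_eq :
    (((X : ℤ[X]) - 1) ^ (p ^ (m + 1) - p ^ m)).map (Int.castRingHom (ZMod p)) =
      (cyclotomic (p ^ (m + 1)) ℤ).map (Int.castRingHom (ZMod p)) := by
  have := cyclotomic_mul_prime_pow_eq (ZMod p) (m := 1) (p := p) hp.out.not_dvd_one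
    (k := m + 1) (by omega)
  simp only [mul_one, cyclotomic_one, Nat.add_sub_cancel] at this
  simp [this]

/-- The value of `g` comes from evaluating at `1`: the left side vanishes and the cyclotomic value
is `p`, so `0 = p + p g(1)`. -/
theorem exists_sub_one_pow_totient :
    ∃ g : ℤ[X], ((X : ℤ[X]) - 1) ^ (p ^ (m + 1) - p ^ m) =
        cyclotomic (p ^ (m + 1)) ℤ + (p : ℤ[X]) * g ∧ g.eval 1 = -1 := by
  obtain ⟨g, hg⟩ := exists_eq_add_natCast_mul_of_map_eq p (map_sub_one_pow_totient_eq p m)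
  refine ⟨g, hg, ?_⟩
  have h1 := congrArg (eval 1) hg
  have hlt : p ^ m < p ^ (m + 1) := Nat.pow_lt_pow_right hp.out.one_lt (by omega)
  have hp0 : (p : ℤ) ≠ 0 := by exact_mod_cast hp.out.ne_zero
  simp only [eval_pow, eval_sub, eval_X, eval_one, sub_self, eval_add, eval_mul, eval_natCast,
    eval_one_cyclotomic_prime_pow] at h1
  rw [zero_pow (by omega)] at h1
  have : (p : ℤ) * (g.eval 1 + 1) = 0 := by linarith
  have := (mul_eq_zero.1 this).resolve_left hp0
  linarith

/-- `Φ` is a sum of `p` powers of `X ^ p ^ m`, so `Φ ≡ p` modulo `X ^ p ^ m - 1`; multiplying by `Φ`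
turns this modulus into `X ^ p ^ (m + 1) - 1`. -/
theorem exists_cyclotomic_mul_self :
    ∃ s : ℤ[X], cyclotomic (p ^ (m + 1)) ℤ * cyclotomic (p ^ (m + 1)) ℤ =
      (p : ℤ[X]) * cyclotomic (p ^ (m + 1)) ℤ + (X ^ p ^ (m + 1) - 1) * s := by
  have h : ((X : ℤ[X]) ^ p ^ m - 1) ∣ cyclotomic (p ^ (m + 1)) ℤ - (p : ℤ[X]) := by
    have : cyclotomic (p ^ (m + 1)) ℤ - (p : ℤ[X]) =
        ∑ i ∈ Finset.range p, (((X : ℤ[X]) ^ p ^ m) ^ i - 1) := by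
      rw [cyclotomic_prime_pow_eq_geom_sum hp.out]
      simp
    rw [this]
    exact Finset.dvd_sum fun i _ => sub_one_dvd_pow_sub_one _ i
  obtain ⟨s, hs⟩ := h
  refine ⟨s, ?_⟩
  rw [← cyclotomic_prime_pow_mul_X_pow_sub_one ℤ p m]
  linear_combination (cyclotomic (p ^ (m + 1)) ℤ) * hs

theorem exists_sub_one_pow_prime_pow :
    ∃ h : ℤ[X], ((X : ℤ[X]) - 1) ^ p ^ m = (X ^ p ^ m - 1) + (p : ℤ[X]) * h := by
  apply exists_eq_add_natCast_mul_of_map_eq p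
  simp only [Polynomial.map_pow, Polynomial.map_sub, map_X, Polynomial.map_one]
  rw [sub_pow_char_pow, one_pow]

theorem X_pow_sub_one_dvd_sub_one_pow :
    ((X : (ZMod (p ^ (m + 1)))[X]) ^ p ^ (m + 1) - 1) ∣
      (X - 1) ^ (p ^ m + (p ^ (m + 1) - p ^ m) * (m + 1)) := by
  obtain ⟨g, hg, hg1⟩ := exists_sub_one_pow_totient p m
  obtain ⟨s₀, hs₀⟩ := exists_cyclotomic_mul_self p m
  obtain ⟨h, hh⟩ := exists_sub_one_pow_prime_pow p m
  obtain ⟨u, s, hu, -⟩ := exists_expansion_add_mul_pow (evalRingHom (1 : ℤ)) hs₀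
    (by simpa using hg1) m
  have hT := cyclotomic_prime_pow_mul_X_pow_sub_one ℤ p m
  -- Over `ℤ`, the only term divisible by neither `p ^ (m + 1)` nor visibly by `T` is `p ^ m (X ^ p
  -- ^ m - 1) Φ u`, which equals `p ^ m T u`.
  have key : ((X : ℤ[X]) - 1) ^ (p ^ m + (p ^ (m + 1) - p ^ m) * (m + 1)) =
      (X ^ p ^ (m + 1) - 1) * ((p : ℤ[X]) ^ m * u + (X ^ p ^ m - 1) * s + (p : ℤ[X]) * h * s) +
      ((p ^ (m + 1) : ℕ) : ℤ[X]) * ((X ^ p ^ m - 1) * g ^ (m + 1) +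
        h * (cyclotomic (p ^ (m + 1)) ℤ * u + (p : ℤ[X]) * g ^ (m + 1))) := by
    rw [pow_add, pow_mul, hg, hh, hu]
    push_cast
    linear_combination ((p : ℤ[X]) ^ m * u) * hT
  have := congrArg (map (Int.castRingHom (ZMod (p ^ (m + 1))))) key
  rw [Polynomial.map_add, Polynomial.map_mul, Polynomial.map_mul, Polynomial.map_natCast,
    CharP.cast_eq_zero (ZMod (p ^ (m + 1)))[X] (p ^ (m + 1)), zero_mul, add_zero] at this
  simp only [Polynomial.map_pow, Polynomial.map_sub, map_X, Polynomial.map_one] at this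
  exact ⟨_, this⟩

/-- Remainders modulo a monic polynomial are linear, and `ℤ[X]` is torsion-free. -/
theorem dvd_of_dvd_natCast_mul {T z : ℤ[X]} (hT : T.Monic) {c : ℕ} (hc : c ≠ 0)
    (h : T ∣ (c : ℤ[X]) * z) : T ∣ z := by
  rw [← modByMonic_eq_zero_iff_dvd hT] at h ⊢
  have h2 : (c : ℤ[X]) * z = (c : ℤ) • z := by simp
  rw [h2, smul_modByMonic] at h
  exact (smul_eq_zero.1 h).resolve_left (by exact_mod_cast hc)

theorem not_X_pow_sub_one_dvd_sub_one_pow :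
    ¬ ((X : (ZMod (p ^ (m + 1)))[X]) ^ p ^ (m + 1) - 1) ∣
      (X - 1) ^ (p ^ m - 1 + (p ^ (m + 1) - p ^ m) * (m + 1)) := by
  intro hdvd
  have hlt : p ^ m < p ^ (m + 1) := Nat.pow_lt_pow_right hp.out.one_lt (by omega)
  have hpos : 0 < p ^ m := Nat.pow_pos hp.out.pos
  obtain ⟨g, hg, hg1⟩ := exists_sub_one_pow_totient p m
  obtain ⟨s₀, hs₀⟩ := exists_cyclotomic_mul_self p m
  obtain ⟨u, s, hu, hu1⟩ := exists_expansion_add_mul_pow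
    ((Int.castRingHom (ZMod p)).comp (evalRingHom (1 : ℤ))) (g := g) hs₀ (by simp [hg1]) m
  have hTm : ((X : ℤ[X]) ^ p ^ (m + 1) - 1).Monic := monic_X_pow_sub_C 1 (by omega)
  set T : ℤ[X] := X ^ p ^ (m + 1) - 1 with hT
  obtain ⟨w, hw⟩ := hdvd
  obtain ⟨w', rfl⟩ := map_surjective (Int.castRingHom (ZMod (p ^ (m + 1))))
    (ZMod.ringHom_surjective _) w
  -- lift the divisibility to `ℤ[X]`
  have hlift : C (((p ^ (m + 1) : ℕ) : ℤ)) ∣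
      ((X : ℤ[X]) - 1) ^ (p ^ m - 1 + (p ^ (m + 1) - p ^ m) * (m + 1)) - T * w' := by
    rw [C_dvd_iff_dvd_coeff]
    intro i
    rw [← ZMod.intCast_zmod_eq_zero_iff_dvd]
    have h0 : (((X : ℤ[X]) - 1) ^ (p ^ m - 1 + (p ^ (m + 1) - p ^ m) * (m + 1)) - T * w').map
        (Int.castRingHom (ZMod (p ^ (m + 1)))) = 0 := by
      rw [Polynomial.map_sub, Polynomial.map_mul, sub_eq_zero, hT]
      simp [hw]
    have := congrArg (fun f => coeff f i) h0
    simpa only [coeff_map, eq_intCast, coeff_zero] using this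
  obtain ⟨w₂, hw₂⟩ := hlift
  have hC : C (((p ^ (m + 1) : ℕ) : ℤ)) = (p : ℤ[X]) ^ (m + 1) := by simp
  rw [hC, pow_add, pow_mul, hg, hu] at hw₂
  set Φ := cyclotomic (p ^ (m + 1)) ℤ
  have h1 : T ∣ ((p ^ m : ℕ) : ℤ[X]) * ((X - 1) ^ (p ^ m - 1) * (Φ * u)
      + (p : ℤ[X]) * ((X - 1) ^ (p ^ m - 1) * g ^ (m + 1) - w₂)) := by
    refine ⟨w' - (X - 1) ^ (p ^ m - 1) * s, ?_⟩
    push_cast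
    linear_combination hw₂
  obtain ⟨v, hv⟩ := dvd_of_dvd_natCast_mul hTm hpos.ne' h1
  -- After division by `p ^ m`, reduction mod `p` leaves only the `Φ u` term, in which `Φ` and `T`
  -- become powers of `X - 1`.
  have hv2 := congrArg (map (Int.castRingHom (ZMod p))) hv
  rw [Polynomial.map_add, Polynomial.map_mul, Polynomial.map_mul, Polynomial.map_mul,
    Polynomial.map_mul, Polynomial.map_natCast, CharP.cast_eq_zero, zero_mul, add_zero,
    ← map_sub_one_pow_totient_eq, hT] at hv2
  simp only [Polynomial.map_pow, Polynomial.map_sub, map_X, Polynomial.map_one] at hv2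
  have hfrob : ((X : (ZMod p)[X]) ^ p ^ (m + 1) - 1) = (X - 1) ^ p ^ (m + 1) := by
    rw [sub_pow_char_pow, one_pow]
  rw [hfrob, ← mul_assoc, ← pow_add] at hv2
  have he : p ^ (m + 1) = p ^ m - 1 + (p ^ (m + 1) - p ^ m) + 1 := by omega
  rw [show (X - 1 : (ZMod p)[X]) ^ p ^ (m + 1) =
    (X - 1) ^ (p ^ m - 1 + (p ^ (m + 1) - p ^ m)) * (X - 1) by rw [← pow_succ, ← he],
    mul_assoc] at hv2
  have hne : (X - 1 : (ZMod p)[X]) ≠ 0 := X_sub_C_ne_zero 1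
  -- Cancelling `(X - 1) ^ (p ^ (m + 1) - 1)` leaves `u = (X - 1) v` mod `p`, against `u(1) = ±1`.
  have h3 := congrArg (eval 1) (mul_left_cancel₀ (pow_ne_zero _ hne) hv2)
  have h4 : (u.map (Int.castRingHom (ZMod p))).eval 1 = ((u.eval 1 : ℤ) : ZMod p) := by
    simp
  rw [h4] at h3
  simp only [RingHom.comp_apply, coe_evalRingHom, eq_intCast] at hu1
  rw [hu1] at h3
  simp at h3

end PrimePower

theorem eq_prime_pow_of_X_pow_sub_one_dvd {k n : ℕ} (hk : 1 < k)
    (h : ((X : (ZMod k)[X]) ^ k - 1) ∣ (X - 1) ^ n) : ∃ p α : ℕ, p.Prime ∧ k = p ^ α := by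
  obtain ⟨p, hp, hpk⟩ := Nat.exists_prime_and_dvd hk.ne'
  have := Fact.mk hp
  obtain ⟨α, q, hq, rfl⟩ := Nat.exists_eq_pow_mul_and_not_dvd (n := k) (by omega) p hp.ne_one
  refine ⟨p, α, hp, ?_⟩
  have hmap := Polynomial.map_dvd (ZMod.castHom hpk (ZMod p)) h
  simp only [Polynomial.map_pow, Polynomial.map_sub, map_X, Polynomial.map_one] at hmap
  have hdvd : ((X : (ZMod p)[X]) ^ q - 1) ∣ (X - 1) ^ n := by
    refine dvd_trans ?_ hmap
    rw [mul_comm, pow_mul]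
    exact sub_one_dvd_pow_sub_one _ _
  -- Separability makes `X ^ q - 1` squarefree, so it divides `X - 1` itself and `q ≤ 1`.
  have hsep : ((X : (ZMod p)[X]) ^ q - 1).Separable := by
    rw [X_pow_sub_one_separable_iff, Ne, ZMod.natCast_eq_zero_iff]
    exact hq
  have h1 : ((X : (ZMod p)[X]) ^ q - 1) ∣ X - 1 :=
    hsep.squarefree.isRadical n _ hdvd
  have hdeg := natDegree_le_of_dvd h1 (X_sub_C_ne_zero 1)
  have e1 : ((X : (ZMod p)[X]) ^ q - 1).natDegree = q := natDegree_X_pow_sub_C (r := 1)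
  have e2 : ((X : (ZMod p)[X]) - 1).natDegree = 1 := natDegree_X_sub_C 1
  rw [e1, e2] at hdeg
  have : q ≠ 0 := by rintro rfl; simp at hq
  have : q = 1 := by omega
  simp [this]

end Polynomial

/-! ### The shift operator on functions. -/

/-- The shift `f ↦ f (· - 1)` on functions `ZMod k → ZMod k`. -/
def ZMod.shift (k : ℕ) : Module.End (ZMod k) (ZMod k → ZMod k) where
  toFun f x := f (x - 1)
  map_add' _ _ := rfl
  map_smul' _ _ := rfl

namespace ZMod

variable {k : ℕ}

theorem shift_apply (f : ZMod k → ZMod k) (x : ZMod k) : shift k f x = f (x - 1) := rfl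

theorem shift_pow_apply (n : ℕ) (f : ZMod k → ZMod k) (x : ZMod k) :
    (shift k ^ n) f x = f (x - n) := by
  induction n generalizing f with
  | zero => simp
  | succ n ih =>
    rw [pow_succ, Module.End.mul_apply, ih, shift_apply]
    congr 1
    push_cast
    ring

theorem shift_pow_self : shift k ^ k = 1 := by
  ext1 f
  funext x
  simp [shift_pow_apply]

theorem shift_sub_one_pow_eq_zero_iff [NeZero k] (hk : 1 < k) (n : ℕ) :
    (shift k - 1) ^ n = 0 ↔ ((X : (ZMod k)[X]) ^ k - 1) ∣ (X - 1) ^ n := by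
  have : Nontrivial (ZMod k) := by
    have := Fact.mk hk
    infer_instance
  have hT : aeval (shift k) ((X : (ZMod k)[X]) ^ k - 1) = 0 := by
    simp [shift_pow_self]
  have hX : aeval (shift k) ((X - 1 : (ZMod k)[X]) ^ n) = (shift k - 1) ^ n := by simp
  have hm : ((X : (ZMod k)[X]) ^ k - 1).Monic := monic_X_pow_sub_C 1 (by omega)
  have hdeg : ((X : (ZMod k)[X]) ^ k - 1).natDegree = k := natDegree_X_pow_sub_C (r := 1)
  constructor
  · intro h
    rw [← modByMonic_eq_zero_iff_dvd hm]
    set r := (X - 1 : (ZMod k)[X]) ^ n %ₘ (X ^ k - 1) with hr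
    have hr0 : aeval (shift k) r = 0 := by
      rw [hr, modByMonic_eq_sub_mul_div, map_sub, map_mul, hT, zero_mul, sub_zero, hX, h]
    have hrdeg : r.natDegree < k := by
      have := natDegree_modByMonic_lt ((X - 1 : (ZMod k)[X]) ^ n) hm (by
        intro h1
        rw [h1, natDegree_one] at hdeg
        omega)
      rwa [hdeg] at this
    ext i
    rw [coeff_zero]
    by_cases hi : i < k
    -- Applied to the delta function at `0`, `r(shift)` takes the value `r.coeff i` at `i`, since
    -- residues below `k` are distinct.
    · have h1 := congrFun (congrArg (fun L : Module.End (ZMod k) (ZMod k → ZMod k) =>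
        L (Pi.single 0 1)) hr0) (i : ZMod k)
      rw [aeval_eq_sum_range' hrdeg] at h1
      simp only [LinearMap.sum_apply, LinearMap.smul_apply, Finset.sum_apply, Pi.smul_apply,
        shift_pow_apply, LinearMap.zero_apply, Pi.zero_apply, smul_eq_mul] at h1
      rw [Finset.sum_eq_single i] at h1
      · simpa using h1
      · intro j hj hji
        rw [Pi.single_eq_of_ne, mul_zero]
        rw [Ne, sub_eq_zero, natCast_eq_natCast_iff', Nat.mod_eq_of_lt hi,
          Nat.mod_eq_of_lt (Finset.mem_range.1 hj)]
        exact fun h => hji h.symm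
      · intro h2
        exact absurd (Finset.mem_range.2 hi) h2
    · exact coeff_eq_zero_of_natDegree_lt (by omega)
  · rintro ⟨s, hs⟩
    rw [← hX, hs, map_mul, hT, zero_mul]

end ZMod

/-! ### The lower central series of the wreath product. -/

namespace RegularWreathProduct

variable {k : ℕ}

/-- A function `ZMod k → ZMod k` as an element of the base group of the wreath product. -/
def ofFun (f : ZMod k → ZMod k) : Multiplicative (ZMod k) ≀ᵣ Multiplicative (ZMod k) :=
  ⟨fun x => Multiplicative.ofAdd (f x.toAdd), 1⟩

theorem ofFun_add (f g : ZMod k → ZMod k) : ofFun (f + g) = ofFun f * ofFun g := by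
  ext x <;> simp [ofFun]

theorem ofFun_zero : ofFun (0 : ZMod k → ZMod k) = 1 := rfl

theorem ofFun_injective : Function.Injective (ofFun (k := k)) := by
  intro f g h
  funext x
  exact Multiplicative.ofAdd.injective
    (congrFun (congrArg RegularWreathProduct.left h) (Multiplicative.ofAdd x))

theorem ofFun_neg (f : ZMod k → ZMod k) : ofFun (-f) = (ofFun f)⁻¹ := by
  rw [eq_inv_iff_mul_eq_one, ← ofFun_add, neg_add_cancel, ofFun_zero]

theorem eq_ofFun_of_right_eq_one (g : Multiplicative (ZMod k) ≀ᵣ Multiplicative (ZMod k))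
    (h : g.right = 1) : g = ofFun fun x => (g.left (Multiplicative.ofAdd x)).toAdd := by
  ext x
  · simp [ofFun]
  · simp [ofFun, h]

theorem commutator_ofFun [NeZero k] (f : ZMod k → ZMod k)
    (g : Multiplicative (ZMod k) ≀ᵣ Multiplicative (ZMod k)) :
    ⁅ofFun f, g⁆ = ofFun (f - (ZMod.shift k ^ (g.right.toAdd).val) f) := by
  apply RegularWreathProduct.ext
  · funext x
    apply Multiplicative.toAdd.injective
    simp [commutatorElement_def, ofFun, ZMod.shift_pow_apply]
    rw [neg_add_eq_sub]
    ring
  · simp [commutatorElement_def, ofFun]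

theorem commutator_eq_ofFun [NeZero k]
    (g h : Multiplicative (ZMod k) ≀ᵣ Multiplicative (ZMod k)) :
    ∃ u v : ZMod k → ZMod k, ⁅g, h⁆ = ofFun ((u - (ZMod.shift k ^ (h.right.toAdd).val) u) -
      (v - (ZMod.shift k ^ (g.right.toAdd).val) v)) := by
  refine ⟨fun x => (g.left (Multiplicative.ofAdd x)).toAdd,
    fun x => (h.left (Multiplicative.ofAdd x)).toAdd, ?_⟩
  apply RegularWreathProduct.ext
  · funext x
    apply Multiplicative.toAdd.injective
    simp [commutatorElement_def, ofFun, ZMod.shift_pow_apply]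
    have e₁ : g.right * (h.right⁻¹ * g.right⁻¹ * x) = x / h.right := by
      rw [div_eq_mul_inv, mul_comm x, mul_comm h.right⁻¹, mul_assoc, mul_inv_cancel_left]
    have e₂ : g.right⁻¹ * x = x / g.right := by rw [div_eq_mul_inv, mul_comm]
    rw [e₁, e₂]
    ring
  · simp [commutatorElement_def, ofFun]

theorem exists_shift_pow_sub (i : ℕ) : ∃ S : Module.End (ZMod k) (ZMod k → ZMod k),
    ZMod.shift k ^ i - 1 = (ZMod.shift k - 1) * S ∧ Commute (ZMod.shift k - 1) S := by
  refine ⟨∑ j ∈ Finset.range i, ZMod.shift k ^ j, (mul_geom_sum _ _).symm, ?_⟩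
  rw [commute_iff_eq, mul_geom_sum, geom_sum_mul]

/-- The subgroup of the base group given by the range of `(shift - 1) ^ n`. -/
def rangeSubgroup (k n : ℕ) :
    Subgroup (Multiplicative (ZMod k) ≀ᵣ Multiplicative (ZMod k)) where
  carrier := {g | ∃ f, g = ofFun (((ZMod.shift k - 1) ^ n) f)}
  one_mem' := ⟨0, by rw [map_zero, ofFun_zero]⟩
  mul_mem' := by
    rintro _ _ ⟨f, rfl⟩ ⟨g, rfl⟩
    exact ⟨f + g, by rw [map_add, ofFun_add]⟩
  inv_mem' := by
    rintro _ ⟨f, rfl⟩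
    exact ⟨-f, by rw [map_neg, ofFun_neg]⟩

/-- The bound starts at index 1 because the term of index 0 is the whole group, not contained in the
base. -/
theorem lowerCentralSeries_succ_le [NeZero k] (n : ℕ) :
    (⊤ : Subgroup (Multiplicative (ZMod k) ≀ᵣ Multiplicative (ZMod k))).lowerCentralSeries (n + 1) ≤
      rangeSubgroup k (n + 1) := by
  induction n with
  | zero =>
    rw [Subgroup.lowerCentralSeries_succ, Subgroup.commutator_le]
    rintro g - h -
    obtain ⟨u, v, huv⟩ := commutator_eq_ofFun g h
    obtain ⟨S, hS, -⟩ := exists_shift_pow_sub (k := k) (h.right.toAdd).val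
    obtain ⟨S', hS', -⟩ := exists_shift_pow_sub (k := k) (g.right.toAdd).val
    refine ⟨S' v - S u, ?_⟩
    rw [huv]
    congr 1
    have h1 := congrArg (fun L : Module.End (ZMod k) (ZMod k → ZMod k) => L u) hS
    have h2 := congrArg (fun L : Module.End (ZMod k) (ZMod k → ZMod k) => L v) hS'
    simp only [LinearMap.sub_apply, Module.End.mul_apply, Module.End.one_apply] at h1 h2
    rw [zero_add, pow_one, map_sub, LinearMap.sub_apply, LinearMap.sub_apply,
      Module.End.one_apply, Module.End.one_apply, ← h1, ← h2]
    abel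
  | succ n ih =>
    rw [Subgroup.lowerCentralSeries_succ, Subgroup.commutator_le]
    rintro g hg h -
    obtain ⟨f, rfl⟩ := ih hg
    obtain ⟨S, hS, hc⟩ := exists_shift_pow_sub (k := k) (h.right.toAdd).val
    refine ⟨-S f, ?_⟩
    rw [commutator_ofFun]
    congr 1
    have h1 : (ZMod.shift k ^ (h.right.toAdd).val - 1) * (ZMod.shift k - 1) ^ (n + 1) =
        (ZMod.shift k - 1) ^ (n + 1 + 1) * S := by
      rw [hS, pow_succ' _ (n + 1), mul_assoc, mul_assoc, (hc.pow_left (n + 1)).eq]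
    have h2 := congrArg (fun L : Module.End (ZMod k) (ZMod k → ZMod k) => L f) h1
    simp only [Module.End.mul_apply, LinearMap.sub_apply, Module.End.one_apply] at h2
    rw [map_neg, ← h2]
    abel

theorem ofFun_mem_lowerCentralSeries [NeZero k] (hk : 1 < k) (n : ℕ) (f : ZMod k → ZMod k) :
    ofFun (((ZMod.shift k - 1) ^ n) f) ∈ (⊤ : Subgroup
      (Multiplicative (ZMod k) ≀ᵣ Multiplicative (ZMod k))).lowerCentralSeries n := by
  induction n generalizing f with
  | zero => trivial
  | succ n ih =>
    -- The commutator applies `1 - shift`, hence the sign.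
    have h := Subgroup.commutator_mem_commutator (ih (-f)) (Subgroup.mem_top
      (inl (Multiplicative.ofAdd 1) : Multiplicative (ZMod k) ≀ᵣ Multiplicative (ZMod k)))
    have := Fact.mk hk
    rw [commutator_ofFun, right_inl, toAdd_ofAdd, ZMod.val_one, pow_one] at h
    rw [Subgroup.lowerCentralSeries_succ]
    convert h using 2
    rw [pow_succ', Module.End.mul_apply, LinearMap.sub_apply, Module.End.one_apply, map_neg,
      map_neg]
    abel

theorem lowerCentralSeries_eq_bot_iff [NeZero k] (hk : 1 < k) (n : ℕ) :
    (⊤ : Subgroup (Multiplicative (ZMod k) ≀ᵣ Multiplicative (ZMod k))).lowerCentralSeries n = ⊥ ↔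
      ((X : (ZMod k)[X]) ^ k - 1) ∣ (X - 1) ^ n := by
  rw [← ZMod.shift_sub_one_pow_eq_zero_iff hk]
  constructor
  · intro h
    refine LinearMap.ext fun f => ?_
    have := ofFun_mem_lowerCentralSeries hk n f
    rw [h, Subgroup.mem_bot, ← ofFun_zero] at this
    exact ofFun_injective this
  · intro h
    cases n with
    | zero =>
      have h1 := congrFun (congrArg (fun L : Module.End (ZMod k) (ZMod k → ZMod k) => L 1) h) 0
      have := Fact.mk hk
      simp at h1
    | succ n =>
      rw [eq_bot_iff]
      refine (lowerCentralSeries_succ_le n).trans ?_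
      rintro _ ⟨f, rfl⟩
      rw [h]
      rfl

end RegularWreathProduct

/-! ### The layerwise action and the permutation group. -/

section Perm

variable {A B I : Type*} [AddCommGroup A] [AddCommGroup B]

/-- The layerwise action of a power of the wreath product of `B` by `A` on `A × B × I`. -/
def wreathPiPerm (A B I : Type*) [AddCommGroup A] [AddCommGroup B] :
    (I → Multiplicative B ≀ᵣ Multiplicative A) →* Equiv.Perm (A × B × I) where
  toFun g :=
    -- Evaluating the base function at the translated coordinate is what makes this a left action.
    { toFun := fun y => (y.1 + (g y.2.2).right.toAdd,
        y.2.1 + ((g y.2.2).left (Multiplicative.ofAdd (y.1 + (g y.2.2).right.toAdd))).toAdd, y.2.2)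
      invFun := fun y => (y.1 - (g y.2.2).right.toAdd,
        y.2.1 - ((g y.2.2).left (Multiplicative.ofAdd y.1)).toAdd, y.2.2)
      left_inv := fun y => by simp
      right_inv := fun y => by simp }
  map_one' := by ext y <;> simp
  map_mul' g h := by
    apply Equiv.ext
    rintro ⟨c, d, j⟩
    have e : (g j).right⁻¹ * Multiplicative.ofAdd
        (c + (((g j).right).toAdd + ((h j).right).toAdd)) =
        Multiplicative.ofAdd (c + ((h j).right).toAdd) := by
      apply Multiplicative.toAdd.injective
      simp only [toAdd_mul, toAdd_inv, toAdd_ofAdd]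
      abel
    simp only [Pi.mul_apply, Equiv.coe_fn_mk, Equiv.Perm.mul_apply,
      RegularWreathProduct.mul_left, RegularWreathProduct.mul_right, toAdd_mul, e]
    refine Prod.ext ?_ (Prod.ext ?_ rfl)
    · dsimp only
      abel
    · dsimp only
      rw [add_right_comm, add_assoc d, add_assoc c, add_comm (h j).right.toAdd, ← add_assoc d]

theorem wreathPiPerm_apply (g : I → Multiplicative B ≀ᵣ Multiplicative A) (y : A × B × I) :
    wreathPiPerm A B I g y = (y.1 + (g y.2.2).right.toAdd,
      y.2.1 + ((g y.2.2).left (Multiplicative.ofAdd (y.1 + (g y.2.2).right.toAdd))).toAdd,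
      y.2.2) := rfl

theorem wreathPiPerm_injective : Function.Injective (wreathPiPerm A B I) := by
  intro g h hgh
  have key : ∀ (j : I) (c : A), _ := fun j c => Equiv.congr_fun hgh (c, 0, j)
  simp only [wreathPiPerm_apply, Prod.mk.injEq, add_right_inj, zero_add, and_true] at key
  funext j
  have hr : (g j).right = (h j).right := Multiplicative.toAdd.injective (key j 0).1
  apply RegularWreathProduct.ext
  · funext x
    have := (key j (x.toAdd - (h j).right.toAdd)).2
    rw [hr, sub_add_cancel] at this
    exact Multiplicative.toAdd.injective this
  · exact hr

open Classical in
/-- The element of the power of the wreath product acting as `twistPerm`. -/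
noncomputable def twistElement (φ₁ : A → B) (φ₂ : B →+ A) (x : A × B × I) (j : I) :
    Multiplicative B ≀ᵣ Multiplicative A :=
  if x.2.2 = j then ⟨fun c => Multiplicative.ofAdd (φ₁ (x.1 - c.toAdd)), 1⟩
  else ⟨1, Multiplicative.ofAdd (φ₂ x.2.1)⟩

theorem wreathPiPerm_twistElement (φ₁ : A → B) (φ₂ : B →+ A) (x : A × B × I) :
    wreathPiPerm A B I (twistElement φ₁ φ₂ x) = twistPerm φ₁ φ₂ x := by
  apply Equiv.ext
  rintro ⟨c, d, j⟩
  by_cases h : x.2.2 = j <;> simp [wreathPiPerm_apply, twistElement, twistPerm, h]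

theorem twistSolution_permutationGroup [Nonempty I] (φ₁ : A → B) (hφ₁ : ∀ a, φ₁ (-a) = φ₁ a)
    (φ₂ : B →+ A) : (twistSolution (I := I) φ₁ hφ₁ φ₂).permutationGroup =
      (Subgroup.closure (Set.range (twistElement (I := I) φ₁ φ₂))).map (wreathPiPerm A B I) := by
  have h : (twistSolution (I := I) φ₁ hφ₁ φ₂).sigma =
      fun x => wreathPiPerm A B I (twistElement φ₁ φ₂ x) := by
    funext x
    rw [wreathPiPerm_twistElement]
    apply Equiv.ext
    exact fun y => rfl
  rw [YBESolution.permutationGroup, h, MonoidHom.map_closure, ← Set.range_comp,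
    Function.comp_def]

theorem nonempty_permutationGroup_mulEquiv [Nonempty I] (φ₁ : A → B)
    (hφ₁ : ∀ a, φ₁ (-a) = φ₁ a) (φ₂ : B →+ A)
    (h : Subgroup.closure (Set.range (twistElement (I := I) φ₁ φ₂)) = ⊤) :
    Nonempty ((twistSolution (I := I) φ₁ hφ₁ φ₂).permutationGroup ≃*
      (I → (Multiplicative B ≀ᵣ Multiplicative A))) := by
  have e := twistSolution_permutationGroup (I := I) φ₁ hφ₁ φ₂
  rw [h, ← MonoidHom.range_eq_map] at e
  exact ⟨(MulEquiv.subgroupCongr e).trans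
    (MonoidHom.ofInjective wreathPiPerm_injective).symm⟩

end Perm

/-! ### The generators fill the whole power. -/

section Generation

variable {I : Type*} {k : ℕ} (φ₁ : ZMod k → ZMod k) (φ₂ : ZMod k →+ ZMod k)

open Classical in
theorem mulSingle_ofFun_mem_closure_twistElement [NeZero k]
    (hφ₁_zero : φ₁ 0 = 0) (hφ₁_one : ∀ x, x ≠ 0 → φ₁ x = 1) (i : I) (f : ZMod k → ZMod k) :
    Pi.mulSingle i (RegularWreathProduct.ofFun f) ∈
      Subgroup.closure (Set.range (twistElement (I := I) φ₁ φ₂)) := by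
  let V : AddSubgroup (ZMod k → ZMod k) :=
    { carrier := {f | Pi.mulSingle i (RegularWreathProduct.ofFun f) ∈
        Subgroup.closure (Set.range (twistElement (I := I) φ₁ φ₂))}
      zero_mem' := by
        rw [Set.mem_ofPred_eq, RegularWreathProduct.ofFun_zero, Pi.mulSingle_one]
        exact one_mem _
      add_mem' := fun {f g} hf hg => by
        rw [Set.mem_ofPred_eq, RegularWreathProduct.ofFun_add, Pi.mulSingle_mul]
        exact mul_mem hf hg
      neg_mem' := fun {f} hf => by
        rw [Set.mem_ofPred_eq, RegularWreathProduct.ofFun_neg, Pi.mulSingle_inv]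
        exact inv_mem hf }
  change f ∈ V
  have hsmul : ∀ (c : ZMod k) (g : ZMod k → ZMod k), g ∈ V → c • g ∈ V := fun c g hg => by
    have : c • g = c.val • g := by
      funext x
      simp
    rw [this]
    exact V.nsmul_mem hg _
  -- Taking `b = 0` trivializes the translations on the other layers.
  have hgen : ∀ a : ZMod k, (fun c => φ₁ (a - c)) ∈ V := fun a => by
    have : Pi.mulSingle i (RegularWreathProduct.ofFun fun c => φ₁ (a - c)) =
        twistElement φ₁ φ₂ (a, 0, i) := by
      funext j
      by_cases h : i = j
      · subst h
        simp [twistElement, RegularWreathProduct.ofFun]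
      · rw [Pi.mulSingle_eq_of_ne (Ne.symm h)]
        simp only [twistElement, h, if_false, map_zero]
        rfl
    change Pi.mulSingle i (RegularWreathProduct.ofFun fun c => φ₁ (a - c)) ∈
      Subgroup.closure (Set.range (twistElement (I := I) φ₁ φ₂))
    rw [this]
    exact Subgroup.subset_closure ⟨_, rfl⟩
  have hval : ∀ a c : ZMod k, φ₁ (a - c) = 1 - Pi.single (M := fun _ => ZMod k) a 1 c := by
    intro a c
    by_cases h : c = a
    · simp [h, hφ₁_zero]
    · rw [hφ₁_one _ (sub_ne_zero.2 (Ne.symm h)), Pi.single_eq_of_ne h, sub_zero]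
  -- Each summand is `1` minus a delta function, so the sum over `a` is `k - 1 = -1`.
  have hone : (1 : ZMod k → ZMod k) ∈ V := by
    have : (1 : ZMod k → ZMod k) = -∑ a, fun c => φ₁ (a - c) := by
      funext c
      simp [hval, Finset.sum_apply, Pi.single_apply]
    rw [this]
    exact V.neg_mem (V.sum_mem fun a _ => hgen a)
  have hsingle : ∀ a : ZMod k, Pi.single a 1 ∈ V := fun a => by
    have : (Pi.single a 1 : ZMod k → ZMod k) = 1 - fun c => φ₁ (a - c) := by
      funext c
      simp [hval]
    rw [this]
    exact V.sub_mem hone (hgen a)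
  rw [pi_eq_sum_univ f]
  refine V.sum_mem fun a _ => hsmul _ _ ?_
  convert hsingle a using 1
  funext c
  simp [Pi.single_apply, eq_comm]

open Classical in
theorem mulSingle_inl_mem_closure_twistElement [Finite I] [NeZero k]
    (hI : Nat.gcd (Nat.card I - 1) k = 1) [Nonempty I]
    (hφ₁_zero : φ₁ 0 = 0) (hφ₁_one : ∀ x, x ≠ 0 → φ₁ x = 1)
    (hφ₂ : Function.Surjective φ₂) (i : I) (a : ZMod k) :
    Pi.mulSingle i (RegularWreathProduct.inl (Multiplicative.ofAdd a)) ∈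
      Subgroup.closure (Set.range (twistElement (I := I) φ₁ φ₂)) := by
  have := Fintype.ofFinite I
  let F : (I → ZMod k) → I → Multiplicative (ZMod k) ≀ᵣ Multiplicative (ZMod k) :=
    fun h j => RegularWreathProduct.inl (Multiplicative.ofAdd (h j))
  have hFsingle : F (Pi.single i a) =
      Pi.mulSingle i (RegularWreathProduct.inl (Multiplicative.ofAdd a)) := by
    funext j
    by_cases h : j = i
    · subst h
      simp [F]
    · simp [F, Pi.single_eq_of_ne h, Pi.mulSingle_eq_of_ne h]
  let V : AddSubgroup (I → ZMod k) :=
    { carrier := {h | F h ∈ Subgroup.closure (Set.range (twistElement (I := I) φ₁ φ₂))}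
      zero_mem' := by
        have : F 0 = 1 := by
          funext j
          simp [F]
        rw [Set.mem_ofPred_eq, this]
        exact one_mem _
      add_mem' := fun {f g} hf hg => by
        have : F (f + g) = F f * F g := by
          funext j
          simp [F]
        rw [Set.mem_ofPred_eq, this]
        exact mul_mem hf hg
      neg_mem' := fun {f} hf => by
        have : F (-f) = (F f)⁻¹ := by
          funext j
          simp [F]
        rw [Set.mem_ofPred_eq, this]
        exact inv_mem hf }
  suffices Pi.single i a ∈ V by
    rw [← hFsingle]
    exact this
  -- Removing the base factor from the generator `(0, b, l)` leaves the translation by `φ₂ b` on all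
  -- layers except `l`.
  have hgen : ∀ (l : I) (c : ZMod k), (fun _ => c) - Pi.single l c ∈ V := fun l c => by
    obtain ⟨b, rfl⟩ := hφ₂ c
    have : F ((fun _ => φ₂ b) - Pi.single l (φ₂ b)) =
        (Pi.mulSingle l (RegularWreathProduct.ofFun fun c => φ₁ (0 - c)))⁻¹ *
          twistElement φ₁ φ₂ (0, b, l) := by
      funext j
      by_cases h : l = j
      · subst h
        simp only [F, twistElement, Pi.sub_apply, Pi.single_eq_same, sub_self, Pi.mul_apply,
          Pi.inv_apply, Pi.mulSingle_eq_same, if_true, ofAdd_zero, map_one]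
        exact (inv_mul_cancel _).symm
      · rw [Pi.mul_apply, Pi.inv_apply, Pi.mulSingle_eq_of_ne (Ne.symm h)]
        simp only [F, twistElement, h, Pi.sub_apply, Pi.single_eq_of_ne (Ne.symm h), sub_zero,
          if_false, inv_one, one_mul]
        rfl
    change F _ ∈ Subgroup.closure (Set.range (twistElement (I := I) φ₁ φ₂))
    rw [this]
    exact mul_mem (inv_mem (mulSingle_ofFun_mem_closure_twistElement φ₁ φ₂ hφ₁_zero hφ₁_one l _))
      (Subgroup.subset_closure ⟨_, rfl⟩)
  have hconst : ∀ c : ZMod k, (fun _ => c) ∈ V := fun c => by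
    obtain ⟨u, hu⟩ := (ZMod.isUnit_iff_coprime (Nat.card I - 1) k).2 hI
    -- Each coordinate is missed by exactly one summand, so the sum is `(|I| - 1) u⁻¹ c = c`.
    have : (fun _ => c : I → ZMod k) = ∑ l, ((fun _ => ↑u⁻¹ * c) - Pi.single l (↑u⁻¹ * c)) := by
      funext j
      rw [Finset.sum_apply]
      simp only [Pi.sub_apply, Finset.sum_sub_distrib, Finset.sum_const, Finset.card_univ,
        Pi.single_apply, Finset.sum_ite_eq, Finset.mem_univ, if_true, nsmul_eq_mul]
      rw [Nat.card_eq_fintype_card, Nat.cast_sub Fintype.card_pos, Nat.cast_one] at hu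
      rw [← sub_one_mul, ← hu, Units.mul_inv_cancel_left]
    rw [this]
    exact V.sum_mem fun l _ => hgen l _
  have := V.sub_mem (hconst a) (hgen i a)
  rwa [sub_sub_cancel] at this

theorem closure_twistElement_eq_top [Finite I] [Nonempty I] [NeZero k]
    (hI : Nat.gcd (Nat.card I - 1) k = 1)
    (hφ₁_zero : φ₁ 0 = 0) (hφ₁_one : ∀ x, x ≠ 0 → φ₁ x = 1)
    (hφ₂ : Function.Surjective φ₂) :
    Subgroup.closure (Set.range (twistElement (I := I) φ₁ φ₂)) = ⊤ := by
  classical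
  rw [eq_top_iff]
  rintro g -
  refine Subgroup.pi_mem_of_mulSingle_mem g fun i => ?_
  have : g i = RegularWreathProduct.ofFun
      (fun x => ((g i).left (Multiplicative.ofAdd x)).toAdd) *
      RegularWreathProduct.inl (Multiplicative.ofAdd (g i).right.toAdd) := by
    ext x <;> simp [RegularWreathProduct.ofFun]
  rw [this, Pi.mulSingle_mul]
  refine mul_mem ?_ ?_
  · convert mulSingle_ofFun_mem_closure_twistElement φ₁ φ₂ hφ₁_zero hφ₁_one i _
  · convert mulSingle_inl_mem_closure_twistElement φ₁ φ₂ hI hφ₁_zero hφ₁_one hφ₂ i _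

end Generation

/-! ### Nilpotency and derived length, transported along an isomorphism. -/

section Transfer

variable {I H : Type*} [Group H] {k : ℕ}

theorem lowerCentralSeries_eq_bot_iff_of_mulEquiv {K : Type*} [Group K] (e : H ≃* K) (n : ℕ) :
    (⊤ : Subgroup H).lowerCentralSeries n = ⊥ ↔ (⊤ : Subgroup K).lowerCentralSeries n = ⊥ := by
  rw [← Subgroup.map_eq_bot_iff_of_injective (f := e.toMonoidHom) _ e.injective,
    show ((⊤ : Subgroup H).lowerCentralSeries n).map e.toMonoidHom =
      (⊤ : Subgroup K).lowerCentralSeries n by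
    rw [Subgroup.map_lowerCentralSeries, Subgroup.map_top_of_surjective _ e.surjective]]

theorem derivedSeries_eq_bot_iff_of_mulEquiv {K : Type*} [Group K] (e : H ≃* K) (n : ℕ) :
    derivedSeries H n = ⊥ ↔ derivedSeries K n = ⊥ := by
  rw [← map_derivedSeries_eq (f := e.toMonoidHom) e.surjective]
  exact (Subgroup.map_eq_bot_iff_of_injective _ e.injective).symm

theorem lowerCentralSeries_pi_wreath_eq_bot_iff [Finite I] [Nonempty I] (hk : 1 < k)
    (e : H ≃* (I → Multiplicative (ZMod k) ≀ᵣ Multiplicative (ZMod k))) (n : ℕ) :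
    (⊤ : Subgroup H).lowerCentralSeries n = ⊥ ↔ ((X : (ZMod k)[X]) ^ k - 1) ∣ (X - 1) ^ n := by
  have : NeZero k := ⟨by omega⟩
  rw [lowerCentralSeries_eq_bot_iff_of_mulEquiv e, Subgroup.top_lowerCentralSeries_pi_of_finite,
    Subgroup.pi_eq_bot_iff, forall_const, RegularWreathProduct.lowerCentralSeries_eq_bot_iff hk]

theorem isNilpotent_of_mulEquiv_pi_wreath [Finite I] [Nonempty I] {p : ℕ} (hp : p.Prime) (m : ℕ)
    (e : H ≃* (I → Multiplicative (ZMod (p ^ (m + 1))) ≀ᵣ Multiplicative (ZMod (p ^ (m + 1))))) :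
    Group.IsNilpotent H := by
  have := Fact.mk hp
  rw [Subgroup.nilpotent_iff_lowerCentralSeries]
  exact ⟨_, (lowerCentralSeries_pi_wreath_eq_bot_iff (Nat.one_lt_pow (by omega) hp.one_lt) e _).2
    (X_pow_sub_one_dvd_sub_one_pow p m)⟩

theorem isNilpotent_iff_of_mulEquiv_pi_wreath [Finite I] [Nonempty I] (hk : 1 < k)
    (e : H ≃* (I → Multiplicative (ZMod k) ≀ᵣ Multiplicative (ZMod k))) :
    Group.IsNilpotent H ↔ ∃ p α : ℕ, p.Prime ∧ k = p ^ α := by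
  constructor
  · rw [Subgroup.nilpotent_iff_lowerCentralSeries]
    rintro ⟨n, hn⟩
    exact eq_prime_pow_of_X_pow_sub_one_dvd hk
      ((lowerCentralSeries_pi_wreath_eq_bot_iff hk e n).1 hn)
  · rintro ⟨p, _ | m, hp, rfl⟩
    · simp at hk
    · exact isNilpotent_of_mulEquiv_pi_wreath hp m e

theorem nilpotencyClass_of_mulEquiv_pi_wreath [Finite I] [Nonempty I] {p : ℕ} (hp : p.Prime)
    (m : ℕ)
    (e : H ≃* (I → Multiplicative (ZMod (p ^ (m + 1))) ≀ᵣ Multiplicative (ZMod (p ^ (m + 1))))) :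
    Group.nilpotencyClass H = ((m + 1) * (p - 1) + 1) * p ^ m := by
  have := Fact.mk hp
  have := isNilpotent_of_mulEquiv_pi_wreath hp m e
  have hk : 1 < p ^ (m + 1) := Nat.one_lt_pow (by omega) hp.one_lt
  have hpos : 0 < p ^ m := Nat.pow_pos hp.pos
  have hle : ∀ n, Group.nilpotencyClass H ≤ n ↔
      ((X : (ZMod (p ^ (m + 1)))[X]) ^ p ^ (m + 1) - 1) ∣ (X - 1) ^ n := fun n => by
    rw [← Subgroup.lowerCentralSeries_eq_bot_iff_nilpotencyClass_le,
      lowerCentralSeries_pi_wreath_eq_bot_iff hk e]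
  have h1 := (hle _).2 (X_pow_sub_one_dvd_sub_one_pow p m)
  have h2 := mt (hle _).1 (not_X_pow_sub_one_dvd_sub_one_pow p m)
  have h3 : ((m + 1) * (p - 1) + 1) * p ^ m = p ^ m + (p ^ (m + 1) - p ^ m) * (m + 1) := by
    have : p ^ (m + 1) - p ^ m = p ^ m * (p - 1) := by
      rw [pow_succ, Nat.mul_sub, mul_one]
    rw [this]
    ring
  omega

theorem isLeast_derivedSeries_eq_bot_of_mulEquiv_pi_wreath [Nonempty I] (hk : 1 < k)
    (e : H ≃* (I → Multiplicative (ZMod k) ≀ᵣ Multiplicative (ZMod k))) :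
    IsLeast {n : ℕ | derivedSeries H n = ⊥} 2 := by
  have : NeZero k := ⟨by omega⟩
  have := Fact.mk hk
  have hmem : ∀ n, n ∈ {n : ℕ | derivedSeries H n = ⊥} ↔ derivedSeries
      (I → Multiplicative (ZMod k) ≀ᵣ Multiplicative (ZMod k)) n = ⊥ := fun n =>
    derivedSeries_eq_bot_iff_of_mulEquiv e n
  constructor
  · rw [hmem, derivedSeries_succ, Subgroup.commutator_eq_bot_iff_le_centralizer]
    let f : (I → Multiplicative (ZMod k) ≀ᵣ Multiplicative (ZMod k)) →*
        (I → Multiplicative (ZMod k)) :=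
      { toFun := fun g i => (g i).right
        map_one' := rfl
        map_mul' := fun _ _ => rfl }
    have hker : derivedSeries (I → Multiplicative (ZMod k) ≀ᵣ Multiplicative (ZMod k)) 1 ≤
        f.ker := by
      rw [derivedSeries_one]
      exact Abelianization.commutator_subset_ker f
    intro g hg h hh
    funext i
    have h1 : (g i).right = 1 := congrFun (hker hg) i
    have h2 : (h i).right = 1 := congrFun (hker hh) i
    rw [Pi.mul_apply, Pi.mul_apply, RegularWreathProduct.eq_ofFun_of_right_eq_one _ h1,
      RegularWreathProduct.eq_ofFun_of_right_eq_one _ h2, ← RegularWreathProduct.ofFun_add,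
      add_comm, RegularWreathProduct.ofFun_add]
  · intro n hn
    rw [hmem] at hn
    by_contra hlt
    have hbot : derivedSeries (I → Multiplicative (ZMod k) ≀ᵣ Multiplicative (ZMod k)) 1 = ⊥ :=
      eq_bot_iff.2 ((derivedSeries_antitone _ (by omega)).trans hn.le)
    rw [derivedSeries_one, commutator_def] at hbot
    -- At `0` this commutator has value `δ₀(0) - δ₀(-1) = 1`, so the group is not abelian.
    have hc := Subgroup.commutator_mem_commutator
      (Subgroup.mem_top (fun _ : I => RegularWreathProduct.ofFun (Pi.single (0 : ZMod k) 1)))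
      (Subgroup.mem_top (fun _ : I => (RegularWreathProduct.inl (Multiplicative.ofAdd 1) :
        Multiplicative (ZMod k) ≀ᵣ Multiplicative (ZMod k))))
    rw [hbot, Subgroup.mem_bot] at hc
    obtain ⟨i⟩ := ‹Nonempty I›
    have hi := congrFun hc i
    change ⁅RegularWreathProduct.ofFun (Pi.single (0 : ZMod k) 1), RegularWreathProduct.inl
      (Multiplicative.ofAdd 1)⁆ = RegularWreathProduct.ofFun 0 at hi
    rw [RegularWreathProduct.commutator_ofFun] at hi
    have h0 := congrFun (RegularWreathProduct.ofFun_injective hi) 0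
    simp [ZMod.shift_apply, ZMod.val_one] at h0

end Transfer

theorem corollary4p2 {I : Type*} [Finite I] [Nontrivial I] (k : ℕ) (hk : 1 < k)
    (hI : Nat.gcd (Nat.card I - 1) k = 1)
    (φ₁ : ZMod k → ZMod k) (hφ₁ : ∀ a, φ₁ (-a) = φ₁ a)
    (hφ₁_zero : φ₁ 0 = 0) (hφ₁_one : ∀ x, x ≠ 0 → φ₁ x = 1)
    (φ₂ : ZMod k →+ ZMod k) (hφ₂ : Function.Surjective φ₂) :
    Nonempty ((twistSolution (I := I) φ₁ hφ₁ φ₂).permutationGroup ≃*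
      (I → (Multiplicative (ZMod k) ≀ᵣ Multiplicative (ZMod k)))) ∧
    IsLeast {n : ℕ |
      derivedSeries (twistSolution (I := I) φ₁ hφ₁ φ₂).permutationGroup n = ⊥} 2 ∧
    (Group.IsNilpotent (twistSolution (I := I) φ₁ hφ₁ φ₂).permutationGroup ↔
      ∃ p α : ℕ, p.Prime ∧ k = p ^ α) ∧
    (∀ p α : ℕ, p.Prime → k = p ^ α →
      Group.nilpotencyClass (twistSolution (I := I) φ₁ hφ₁ φ₂).permutationGroup =
        (α * (p - 1) + 1) * p ^ (α - 1)) ∧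
    (∀ p : ℕ, p.Prime → k = p →
      Group.nilpotencyClass (twistSolution (I := I) φ₁ hφ₁ φ₂).permutationGroup = p) := by
  have : NeZero k := ⟨by omega⟩
  have hiso := nonempty_permutationGroup_mulEquiv (I := I) φ₁ hφ₁ φ₂
    (closure_twistElement_eq_top φ₁ φ₂ hI hφ₁_zero hφ₁_one hφ₂)
  obtain ⟨e⟩ := hiso
  have hclass : ∀ p α : ℕ, p.Prime → k = p ^ α →
      Group.nilpotencyClass (twistSolution (I := I) φ₁ hφ₁ φ₂).permutationGroup =
        (α * (p - 1) + 1) * p ^ (α - 1) := by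
    -- `α = 0` would give `k = 1`, so the subtraction in `α - 1` never truncates.
    rintro p (_ | m) hp rfl
    · simp at hk
    · exact nilpotencyClass_of_mulEquiv_pi_wreath hp m e
  refine ⟨⟨e⟩, isLeast_derivedSeries_eq_bot_of_mulEquiv_pi_wreath hk e,
    isNilpotent_iff_of_mulEquiv_pi_wreath hk e, hclass, fun p hp hkp => ?_⟩
  have hpos := hp.one_lt
  rw [hclass p 1 hp (by rw [hkp, pow_one])]
  simp
  omega
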